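/- Let $z_0,\alpha,\beta\in\mathbb C$. Let $y_I$ be the solution, meromorphic on $\mathbb C$, of the first Painlevé equation $y''=6y^2+z$ with $y_I(z_0)=\alpha$, $y_I'(z_0)=\beta$. For $\epsilon\in\mathbb C\setminus\{0\}$ let $y=y(\cdot\,;\epsilon)$ be the solution, meromorphic on $\mathbb C$, of the equation $P_{II}(\epsilon)$, $$y''=6y^2+z+\epsilon^6\{2y^3+zy\},$$ with the same initial data $y(z_0)=\alpha$, $y'(z_0)=\beta$. Let $\hat z$ be a double pole of $y_I$. Then there is a constant $C>0$, independent of $\epsilon$, such that the following holds. Let $\delta>0$ be so small that $y_I$ has neither a pole nor a zero of $y_I'$ in $\{0<|z-\hat z|\le\delta\}$, and let $0<\nu<1$ and $\eta>0$. Then there is $r>0$ such that for all $\epsilon$ with $0<|\epsilon|<r$: 1. $y$ has exactly two poles $z_+\ne z_-$ in the disc $|z-\hat z|<\delta$; both are simple, and their residues are opposite, namely $\epsilon^{-3}$ at $z_+$ and $-\epsilon^{-3}$ at $z_-$; 2. $y'$ has exactly one zero $z_1$ in the disc $|z-\hat z|<\delta$, and $A:=|y(z_1)|$ satisfies $\left|\dfrac{A}{4|\epsilon|^{-6}}-1\right|\le\eta$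 (that is, $A\sim 4|\epsilon|^{-6}$ as $\epsilon\to0$); 3. $|z_+-z_-|\le\dfrac{4}{\nu A|\epsilon|^3}$; 4. $|z_+-z_-|\le C|\epsilon|^3$, $|z_+-\hat z|\le C|\epsilon|^3$ and $|z_--\hat z|\le C|\epsilon|^3$: the two poles coalesce into the double pole at rate $O(\epsilon^3)$. -/

import Mathlib

open Filter Topology Metric

/-- `y` is a meromorphic function on `ℂ` (with removable singularities removed; its values at
the poles are irrelevant) that solves `y'' = f(z, y)` at every point that is not a pole. -/
structure IsMeromorphicSolution (f : ℂ → ℂ → ℂ) (y : ℂ → ℂ) : Prop where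
  meromorphicAt : ∀ z, MeromorphicAt y z
  analyticAt : ∀ z, 0 ≤ meromorphicOrderAt y z → AnalyticAt ℂ y z
  ode : ∀ z, AnalyticAt ℂ y z → deriv (deriv y) z = f z (y z)

/-- `y` solves the first Painlevé equation `y'' = 6 y² + z`. -/
def SolvesPI (y : ℂ → ℂ) : Prop :=
  IsMeromorphicSolution (fun z w => 6 * w ^ 2 + z) y

/-- `y` solves `P_II(ε)`: `y'' = 6 y² + z + ε⁶ (2 y³ + z y)`. -/
def SolvesPII (ε : ℂ) (y : ℂ → ℂ) : Prop :=
  IsMeromorphicSolution (fun z w => 6 * w ^ 2 + z + ε ^ 6 * (2 * w ^ 3 + z * w)) y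

/-- The initial conditions `y(z₀) = α`, `y'(z₀) = β`, at a point `z₀` that is not a pole. -/
def HasInitialData (y : ℂ → ℂ) (z₀ α β : ℂ) : Prop :=
  AnalyticAt ℂ y z₀ ∧ y z₀ = α ∧ deriv y z₀ = β

/-- `y` has a pole (of any order) at `p`. -/
def IsPole (y : ℂ → ℂ) (p : ℂ) : Prop :=
  MeromorphicAt y p ∧ meromorphicOrderAt y p < 0

/-- `y` has a simple pole at `p`, with residue `c`. -/
def IsSimplePoleWithResidue (y : ℂ → ℂ) (p c : ℂ) : Prop :=
  MeromorphicAt y p ∧ meromorphicOrderAt y p = -1 ∧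
    Tendsto (fun z => (z - p) * y z) (𝓝[≠] p) (𝓝 c)

/-- `z₁` is a stationary point of `y`: a zero of `y'` that is not a pole of `y`. -/
def IsStationaryPoint (y : ℂ → ℂ) (z₁ : ℂ) : Prop :=
  AnalyticAt ℂ y z₁ ∧ deriv y z₁ = 0

/-!
Throughout, the first Painlevé equation is the case `ε = 0` of `P_II(ε)`, and the parameter enters
only through `μ = ε⁶`.

Away from the poles of `yI` the pair `(y, y')` solves a polynomial system that depends
polynomially on `μ`. Gronwall's inequality along rays (`exists_eventually_norm_sub_le_mul`) shows
that closeness of order `O(μ)` at the centre of a disc extends to the disc. The pole-free region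
of `yI` is connected, so `y - yI` and `y' - yI'` are `O(μ)` on each of its compact subsets
(`approachesOn_of_isCompact`). No solution has to be constructed: `y` is meromorphic on the plane,
and a meromorphic function that is bounded along a ray has no pole at the end of it.

Near the pole `zhat` the same argument is applied to the functions `u = 1/y`, `p = u'` and
`V = y'² - 4y³ - μy⁴ - 2zy - μzy² + y'/y`. They solve the polynomial system
`u' = p`, `p' = 2 + μzu + 3zu² + 2u³V + 2u²p`, `V' = -zu - up - u²V`, with the first integral
`p² = μ + u (4 + h)`, `h = μzu + 2zu² + u³V + u²p`, and they stay regular at the poles of `y`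
(`SolvesPII.mem_regularSet_of_order_neg`). So `(u, p, V)` is `O(μ)`-close to its analogue
for `yI` on a full disc around `zhat`, where `u_I(zhat) = u_I'(zhat) = 0`; on a small disc `p'` is
close to `2` and `h` is close to `0`.

The statement can now be read off (`exists_zeros_of_nearly_double_zero`). The map `p` is injective
and takes each of the values `ε³`, `-ε³` and `0` exactly once. By the first integral, `p = ± ε³`
forces `u = 0`, and conversely; these two points are the poles of `y`, with residues
`1/p = ± ε⁻³`. The point with `p = 0` is the stationary point, and there `u (4 + h) = -ε⁶`, that
is, `|y| ≈ 4 |ε|⁻⁶`. The distances follow from `p' ≈ 2`, `p(z₊) - p(z₋) = 2ε³` and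
`p(zhat) = O(ε⁶)`.
-/

/-! ### Stability of differential equations under small perturbations -/

theorem gronwallBound_mul_left (c δ K ε x : ℝ) :
    gronwallBound (c * δ) K (c * ε) x = c * gronwallBound δ K ε x := by
  unfold gronwallBound
  split_ifs <;> ring

/-- Gronwall's inequality along the segment from `a` to `a + T (b - a)`, uniform in `b` with
`‖b - a‖ ≤ R`. -/
theorem norm_le_of_segment {E : Type*} [NormedAddCommGroup E] [NormedSpace ℂ E]
    {a b : ℂ} {R L c T : ℝ} (hR : 0 ≤ R) (hL : 0 ≤ L) (hc : 0 ≤ c)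
    {f f' : ℂ → E} (hb : ‖b - a‖ ≤ R) (hT : T ∈ Set.Icc (0 : ℝ) 1)
    (hf : ∀ t ∈ Set.Icc 0 T, HasDerivAt f (f' (a + (t : ℂ) * (b - a))) (a + (t : ℂ) * (b - a)))
    (hf' : ∀ t ∈ Set.Icc 0 T,
      ‖f' (a + (t : ℂ) * (b - a))‖ ≤ L * ‖f (a + (t : ℂ) * (b - a))‖ + c)
    (ha : ‖f a‖ ≤ c) :
    ‖f (a + (T : ℂ) * (b - a))‖ ≤ gronwallBound 1 (R * L) R 1 * c := by
  let γ : ℝ → ℂ := fun t => a + (t : ℂ) * (b - a)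
  have hγ : ∀ t, HasDerivAt γ (b - a) t := fun t => by
    have h := ((Complex.ofRealCLM.hasDerivAt (x := t)).mul_const (b - a)).const_add a
    simpa [γ] using h
  have hd : ∀ t ∈ Set.Icc 0 T, HasDerivAt (fun s => f (γ s)) ((b - a) • f' (γ t)) t :=
    fun t ht => HasDerivAt.scomp t (hf t ht) (hγ t)
  have key := norm_le_gronwallBound_of_norm_deriv_right_le (f := fun s => f (γ s))
    (f' := fun t => (b - a) • f' (γ t)) (δ := c) (K := R * L) (ε := R * c) (a := 0) (b := T)
    (fun t ht => (hd t ht).continuousAt.continuousWithinAt)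
    (fun t ht => (hd t ⟨ht.1, ht.2.le⟩).hasDerivWithinAt)
    (by simpa [γ] using ha)
    (fun t ht => by
      rw [norm_smul]
      calc ‖b - a‖ * ‖f' (γ t)‖ ≤ R * (L * ‖f (γ t)‖ + c) :=
            mul_le_mul hb (hf' t ⟨ht.1, ht.2.le⟩) (norm_nonneg _) hR
        _ = _ := by ring)
    T ⟨hT.1, le_rfl⟩
  have e : gronwallBound c (R * L) (R * c) 1 = gronwallBound 1 (R * L) R 1 * c := by
    have := gronwallBound_mul_left c 1 (R * L) R 1
    rw [mul_one, mul_comm c R] at this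
    rw [this, mul_comm]
  rw [← e]
  refine key.trans (gronwallBound_mono hc (by positivity) (by positivity) ?_)
  simpa using hT.2

/-- Continuation along rays: an inequality `‖Y - X‖ ≤ 1` that holds at the centre of a disc is
propagated to the whole disc, because Gronwall's inequality improves it as long as it holds.
The set `D` is where `Y` is regular; `hext` says that `Y` can only cease to be regular by leaving
the unit tube around `X`. -/
theorem mem_and_norm_sub_le_of_tube {E : Type*} [NormedAddCommGroup E] [NormedSpace ℂ E]
    {a : ℂ} {R L c : ℝ} (hR : 0 ≤ R) (hL : 0 ≤ L) (hc : 0 ≤ c)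
    {F G : ℂ → E → E} {X Y : ℂ → E} {D : Set ℂ}
    (hX : ∀ z ∈ closedBall a R, HasDerivAt X (F z (X z)) z)
    (hY : ∀ z ∈ D, HasDerivAt Y (G z (Y z)) z)
    (hFG : ∀ z ∈ closedBall a R, ∀ w, ‖w - X z‖ ≤ 1 →
      ‖G z w - F z (X z)‖ ≤ L * ‖w - X z‖ + c)
    (hD : IsOpen D)
    (hext : ∀ b ∈ closedBall a R, (∀ t ∈ Set.Ico (0 : ℝ) 1, a + (t : ℂ) * (b - a) ∈ D ∧
      ‖Y (a + (t : ℂ) * (b - a)) - X (a + (t : ℂ) * (b - a))‖ ≤ 1) → b ∈ D)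
    (ha : a ∈ D) (hac : ‖Y a - X a‖ ≤ c)
    (hc1 : gronwallBound 1 (R * L) R 1 * c < 1) :
    ∀ b ∈ closedBall a R, b ∈ D ∧ ‖Y b - X b‖ ≤ gronwallBound 1 (R * L) R 1 * c := by
  intro b hb
  have hba : ‖b - a‖ ≤ R := by simpa [dist_eq_norm] using hb
  let γ : ℝ → ℂ := fun t => a + (t : ℂ) * (b - a)
  have hγc : Continuous γ := by fun_prop
  have hγ : ∀ t ∈ Set.Icc (0 : ℝ) 1, γ t ∈ closedBall a R := by
    intro t ht
    have : ‖(t : ℂ) * (b - a)‖ ≤ 1 * R := by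
      rw [norm_mul]
      refine mul_le_mul ?_ hba (norm_nonneg _) zero_le_one
      simpa [abs_of_nonneg ht.1] using ht.2
    simpa [γ, dist_eq_norm] using this
  let good : ℝ → Prop := fun t => γ t ∈ D ∧ ‖Y (γ t) - X (γ t)‖ ≤ 1
  let S : Set ℝ := {t | ∀ s ∈ Set.Icc 0 t, good s}
  have improve : ∀ T ∈ Set.Icc (0 : ℝ) 1, T ∈ S →
      ‖Y (γ T) - X (γ T)‖ ≤ gronwallBound 1 (R * L) R 1 * c := by
    intro T hT hTS
    refine norm_le_of_segment (f := fun z => Y z - X z)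
      (f' := fun z => G z (Y z) - F z (X z)) hR hL hc hba hT ?_ ?_ hac
    · intro t ht
      exact (hY _ (hTS t ht).1).sub (hX _ (hγ t ⟨ht.1, ht.2.trans hT.2⟩))
    · intro t ht
      exact hFG _ (hγ t ⟨ht.1, ht.2.trans hT.2⟩) _ (hTS t ht).2
  have hcont : ∀ t ∈ Set.Icc (0 : ℝ) 1, γ t ∈ D →
      ContinuousAt (fun s => ‖Y (γ s) - X (γ s)‖) t := by
    intro t ht htD
    have h1 : ContinuousAt (fun z => ‖Y z - X z‖) (γ t) :=
      ((hY _ htD).continuousAt.sub (hX _ (hγ t ht)).continuousAt).norm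
    exact ContinuousAt.comp (g := fun z => ‖Y z - X z‖) h1 hγc.continuousAt
  -- being good on `[0, t)` passes to the endpoint `t`
  have hclose : ∀ t ∈ Set.Icc (0 : ℝ) 1, (∀ s ∈ Set.Ico 0 t, good s) → good 0 → good t := by
    intro t ht hs h0
    rcases eq_or_lt_of_le ht.1 with h | hpos
    · rwa [← h]
    have htD : γ t ∈ D := by
      refine hext _ (hγ t ht) fun s hs' => ?_
      have : a + (s : ℂ) * (γ t - a) = γ (s * t) := by simp only [γ]; push_cast; ring
      rw [this]
      exact hs _ ⟨mul_nonneg hs'.1 ht.1, by nlinarith [hs'.2]⟩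
    refine ⟨htD, ?_⟩
    have hlim := (hcont t ht htD).tendsto.mono_left (nhdsWithin_le_nhds (s := Set.Iio t))
    refine le_of_tendsto hlim ?_
    filter_upwards [Ioo_mem_nhdsLT hpos] with s hs'
    exact (hs s ⟨hs'.1.le, hs'.2⟩).2
  have h0 : good 0 := by
    refine ⟨by simpa [γ] using ha, ?_⟩
    have h1 : 1 ≤ gronwallBound 1 (R * L) R 1 := by
      have := gronwallBound_mono (δ := 1) (K := R * L) (ε := R) zero_le_one hR (by positivity)
        (zero_le_one' ℝ)
      rwa [gronwallBound_x0] at this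
    have : ‖Y a - X a‖ ≤ 1 := hac.trans (by nlinarith)
    simpa [γ] using this
  have hS : Set.Icc (0 : ℝ) 1 ⊆ S := by
    refine IsClosed.Icc_subset_of_forall_exists_gt ?_ ?_ ?_
    · refine isClosed_of_closure_subset fun t ht => ?_
      have htI : t ∈ Set.Icc (0 : ℝ) 1 :=
        closure_minimal Set.inter_subset_right isClosed_Icc ht
      have hlt : ∀ s ∈ Set.Ico 0 t, good s := by
        intro s hs
        obtain ⟨t', ht', hst⟩ := mem_closure_iff.1 ht (Set.Ioi s) isOpen_Ioi hs.2
        exact hst.1 s ⟨hs.1, le_of_lt ht'⟩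
      refine ⟨fun s hs => ?_, htI⟩
      rcases eq_or_lt_of_le hs.2 with h | h
      · rw [h]; exact hclose t htI hlt h0
      · exact hlt s ⟨hs.1, h⟩
    · intro s hs
      have : s = 0 := le_antisymm hs.2 hs.1
      rwa [this]
    · rintro T ⟨hTS, hT⟩ y hy
      have hTI : T ∈ Set.Icc (0 : ℝ) 1 := ⟨hT.1, hT.2.le⟩
      have hgT := hTS T ⟨hT.1, le_rfl⟩
      have ev : ∀ᶠ s in 𝓝 T, good s := by
        have e1 : ∀ᶠ s in 𝓝 T, γ s ∈ D := hγc.continuousAt.eventually_mem (hD.mem_nhds hgT.1)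
        have e2 := (hcont T hTI hgT.1).eventually_lt continuousAt_const
          ((improve T hTI hTS).trans_lt hc1)
        filter_upwards [e1, e2] with s h1 h2 using ⟨h1, h2.le⟩
      obtain ⟨d, hd, hdg⟩ := Metric.eventually_nhds_iff.1 ev
      have hyT : T < y := hy
      have hm : T < min y (T + d / 2) := lt_min hyT (by linarith)
      refine ⟨min y (T + d / 2), fun s hs => ?_, hm, min_le_left _ _⟩
      rcases le_or_gt s T with h | h
      · exact hTS s ⟨hs.1, h⟩
      · refine hdg ?_
        rw [Real.dist_eq, abs_of_pos (by linarith)]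
        have := hs.2.trans (min_le_right y (T + d / 2))
        linarith
  have h1 : (1 : ℝ) ∈ Set.Icc (0 : ℝ) 1 := ⟨zero_le_one, le_rfl⟩
  have hγ1 : γ 1 = b := by simp [γ]
  have hb1 := (hS h1 1 h1).1
  have hb2 := improve 1 h1 (hS h1)
  rw [hγ1] at hb1 hb2
  exact ⟨hb1, hb2⟩

/-- Dependence on a small parameter `c i → 0` for the system `Y' = F(z, Y) + c i • H(z, Y)`: an
`O(c i)` deviation from a solution `X` of the limit system at the centre of a disc on which `X`
is regular stays `O(c i)`, uniformly on the disc. -/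
theorem exists_eventually_norm_sub_le_mul {E ι : Type*} [NormedAddCommGroup E] [NormedSpace ℂ E]
    [ProperSpace E] {l : Filter ι} {c : ι → ℂ} (hc : Tendsto c l (𝓝 0))
    {a : ℂ} {R : ℝ} (hR : 0 ≤ R) {F H : ℂ × E → E} (hF : ContDiff ℂ 1 F) (hH : Continuous H)
    {X : ℂ → E} {Y : ι → ℂ → E} {D : ι → Set ℂ}
    (hX : ∀ z ∈ closedBall a R, HasDerivAt X (F (z, X z)) z)
    (hY : ∀ i, ∀ z ∈ D i, HasDerivAt (Y i) (F (z, Y i z) + c i • H (z, Y i z)) z)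
    (hD : ∀ i, IsOpen (D i))
    (hext : ∀ i, ∀ b ∈ closedBall a R, ∀ M : ℝ, (∀ t ∈ Set.Ico (0 : ℝ) 1,
      a + (t : ℂ) * (b - a) ∈ D i ∧ ‖Y i (a + (t : ℂ) * (b - a))‖ ≤ M) → b ∈ D i)
    (ha : ∃ K : ℝ, ∀ᶠ i in l, a ∈ D i ∧ ‖Y i a - X a‖ ≤ K * ‖c i‖) :
    ∃ K : ℝ, ∀ᶠ i in l, ∀ b ∈ closedBall a R, b ∈ D i ∧ ‖Y i b - X b‖ ≤ K * ‖c i‖ := by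
  obtain ⟨K₀, hK₀⟩ := ha
  have hXc : ContinuousOn X (closedBall a R) :=
    fun z hz => (hX z hz).continuousAt.continuousWithinAt
  obtain ⟨M, hM⟩ := (isCompact_closedBall a R).exists_bound_of_continuousOn hXc
  have hM0 : 0 ≤ M := (norm_nonneg _).trans (hM a (mem_closedBall_self hR))
  let Q : Set (ℂ × E) := closedBall a R ×ˢ closedBall 0 (M + 1)
  have hQ : IsCompact Q := (isCompact_closedBall a R).prod (isCompact_closedBall 0 (M + 1))
  obtain ⟨B, hB⟩ := hQ.exists_bound_of_continuousOn hH.continuousOn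
  obtain ⟨L, hL⟩ : ∃ L : NNReal, LipschitzOnWith L F Q := by
    obtain ⟨L, hL⟩ :=
      hQ.exists_bound_of_continuousOn (hF.continuous_fderiv one_ne_zero).continuousOn
    refine ⟨⟨max L 0, le_max_right _ _⟩, ?_⟩
    refine Convex.lipschitzOnWith_of_nnnorm_fderiv_le (𝕜 := ℂ)
      (fun x _ => (hF.differentiable one_ne_zero).differentiableAt) (fun x hx => ?_)
      ((convex_closedBall a R).prod (convex_closedBall 0 (M + 1)))
    exact (hL x hx).trans (le_max_left _ _)
  let K₁ := max K₀ (max B 0)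
  have hK₁ : 0 ≤ K₁ := (le_max_right _ _).trans (le_max_right _ _)
  let g := gronwallBound 1 (R * L) R 1
  refine ⟨g * K₁, ?_⟩
  have hsmall : ∀ᶠ i in l, g * (K₁ * ‖c i‖) < 1 := by
    have : Tendsto (fun i => g * (K₁ * ‖c i‖)) l (𝓝 (g * (K₁ * ‖(0 : ℂ)‖))) :=
      (hc.norm.const_mul K₁).const_mul g
    simp only [norm_zero, mul_zero] at this
    exact this.eventually_lt_const one_pos
  filter_upwards [hK₀, hsmall] with i hi hi1
  have tube : ∀ z ∈ closedBall a R, ∀ w, ‖w - X z‖ ≤ 1 → w ∈ closedBall (0 : E) (M + 1) := by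
    intro z hz w hw
    rw [mem_closedBall_zero_iff]
    calc ‖w‖ = ‖X z + (w - X z)‖ := by congr 1; abel
      _ ≤ ‖X z‖ + ‖w - X z‖ := norm_add_le _ _
      _ ≤ M + 1 := add_le_add (hM z hz) hw
  have := mem_and_norm_sub_le_of_tube (a := a) (R := R) (L := L) (c := K₁ * ‖c i‖) hR L.2
    (by positivity) (F := fun z w => F (z, w)) (G := fun z w => F (z, w) + c i • H (z, w))
    (X := X) (Y := Y i) (D := D i) hX (hY i) ?_ (hD i) ?_ hi.1
    (hi.2.trans (by gcongr; exact le_max_left _ _)) hi1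
  · intro b hb
    refine ⟨(this b hb).1, (this b hb).2.trans_eq ?_⟩
    ring
  · intro z hz w hw
    have hwQ := tube z hz w hw
    have hXQ := tube z hz (X z) (by simp)
    have h1 : ‖F (z, w) - F (z, X z)‖ ≤ L * ‖w - X z‖ := by
      have := hL.norm_sub_le (x := (z, w)) (y := (z, X z)) ⟨hz, hwQ⟩ ⟨hz, hXQ⟩
      simpa [Prod.norm_def] using this
    have h2 : ‖c i • H (z, w)‖ ≤ K₁ * ‖c i‖ := by
      rw [norm_smul, mul_comm]
      gcongr
      exact (hB (z, w) ⟨hz, hwQ⟩).trans ((le_max_left _ _).trans (le_max_right _ _))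
    calc ‖F (z, w) + c i • H (z, w) - F (z, X z)‖
        = ‖(F (z, w) - F (z, X z)) + c i • H (z, w)‖ := by congr 1; abel
      _ ≤ _ := (norm_add_le _ _).trans (add_le_add h1 h2)
  · intro b hb h
    refine hext i b hb (M + 1) fun t ht => ⟨(h t ht).1, ?_⟩
    refine mem_closedBall_zero_iff.1 (tube _ ?_ _ (h t ht).2)
    have hba : ‖b - a‖ ≤ R := by simpa [dist_eq_norm] using hb
    have : ‖(t : ℂ) * (b - a)‖ ≤ 1 * R := by
      rw [norm_mul]
      refine mul_le_mul ?_ hba (norm_nonneg _) zero_le_one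
      simpa [abs_of_nonneg ht.1] using ht.2.le
    simpa [dist_eq_norm] using this

/-! ### Poles of meromorphic functions -/

/-- A meromorphic function that is bounded on a segment has no pole at the end of the segment. -/
theorem meromorphicOrderAt_nonneg_of_norm_le_on_segment {f : ℂ → ℂ} {a b : ℂ} {M : ℝ}
    (hab : a ≠ b)
    (h : ∀ t ∈ Set.Ico (0 : ℝ) 1, ‖f (a + (t : ℂ) * (b - a))‖ ≤ M) :
    0 ≤ meromorphicOrderAt f b := by
  by_contra hneg
  have hlim := tendsto_norm_cobounded_atTop.comp
    (tendsto_cobounded_of_meromorphicOrderAt_neg (not_le.1 hneg))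
  have hγ : Tendsto (fun t : ℝ => a + (t : ℂ) * (b - a)) (𝓝[<] 1) (𝓝[≠] b) := by
    refine tendsto_nhdsWithin_iff.2 ⟨?_, ?_⟩
    · have : Continuous (fun t : ℝ => a + (t : ℂ) * (b - a)) := by fun_prop
      have := (this.tendsto 1).mono_left (nhdsWithin_le_nhds (s := Set.Iio 1))
      simpa using this
    · filter_upwards [self_mem_nhdsWithin] with t ht hb
      have h1 : ((t : ℂ) - 1) * (b - a) = 0 := by
        have : a + (t : ℂ) * (b - a) = b := hb
        linear_combination this
      rcases mul_eq_zero.1 h1 with h1 | h1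
      · have : t = 1 := by exact_mod_cast sub_eq_zero.1 h1
        exact (ne_of_lt ht) this
      · exact hab (sub_eq_zero.1 h1).symm
  have h1 := (hlim.comp hγ).eventually_gt_atTop M
  have h2 : ∀ᶠ t : ℝ in 𝓝[<] 1, t ∈ Set.Ioo (0 : ℝ) 1 := Ioo_mem_nhdsLT one_pos
  obtain ⟨t, ht1, ht2⟩ := (h1.and h2).exists
  exact absurd (h t ⟨ht2.1.le, ht2.2⟩) (not_le.2 ht1)

/-- If `V' = h + V g` with `g`, `h` analytic, then `V` has no pole: the order of `V'` at a pole
would be smaller than that of the right-hand side. -/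
theorem meromorphicOrderAt_nonneg_of_deriv_eq {V g h : ℂ → ℂ} {x : ℂ}
    (hV : MeromorphicAt V x) (hg : AnalyticAt ℂ g x) (hh : AnalyticAt ℂ h x)
    (hode : deriv V =ᶠ[𝓝[≠] x] h + V * g) : 0 ≤ meromorphicOrderAt V x := by
  by_contra hneg
  rw [not_le] at hneg
  obtain ⟨n, hn⟩ := WithTop.ne_top_iff_exists.1 (ne_top_of_lt hneg)
  rw [← hn] at hneg
  have hn0 : n < 0 := by exact_mod_cast hneg
  have h1 : meromorphicOrderAt (deriv V) x = ((n - 1 : ℤ) : WithTop ℤ) :=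
    meromorphicOrderAt_deriv_eq_sub_one (by exact_mod_cast hn0.ne) hn.symm
  have h2 : (n : WithTop ℤ) ≤ meromorphicOrderAt (h + V * g) x := by
    refine le_trans ?_ (meromorphicOrderAt_add hh.meromorphicAt (hV.mul hg.meromorphicAt))
    refine le_min (le_trans (by exact_mod_cast hn0.le) hh.meromorphicOrderAt_nonneg) ?_
    rw [meromorphicOrderAt_mul hV hg.meromorphicAt, ← hn]
    exact le_add_of_nonneg_right hg.meromorphicOrderAt_nonneg
  rw [← meromorphicOrderAt_congr hode, h1] at h2
  have : n ≤ n - 1 := by exact_mod_cast h2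
  omega

/-! ### Convergence away from the poles -/

theorem solvesPII_zero_iff {y : ℂ → ℂ} : SolvesPII 0 y ↔ SolvesPI y := by
  simp [SolvesPII, SolvesPI]

theorem SolvesPII.hasDerivAt_prod {ε : ℂ} {y : ℂ → ℂ} (hy : SolvesPII ε y) {z : ℂ}
    (hz : AnalyticAt ℂ y z) :
    HasDerivAt (fun w => (y w, deriv y w))
      (deriv y z, 6 * y z ^ 2 + z + ε ^ 6 * (2 * y z ^ 3 + z * y z)) z := by
  have h := hz.deriv.differentiableAt.hasDerivAt
  rw [hy.ode z hz] at h
  exact hz.differentiableAt.hasDerivAt.prodMk h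

/-- The solutions `Y i` of `P_II(e i)` approach `yI` at the rate `O(e i ^ 6)` on `K`, together
with their derivatives. -/
def ApproachesOn {ι : Type*} (l : Filter ι) (e : ι → ℂ) (Y : ι → ℂ → ℂ) (yI : ℂ → ℂ)
    (K : Set ℂ) : Prop :=
  ∃ C : ℝ, ∀ᶠ i in l, ∀ z ∈ K, AnalyticAt ℂ (Y i) z ∧
    ‖(Y i z, deriv (Y i) z) - (yI z, deriv yI z)‖ ≤ C * ‖e i ^ 6‖

section Family

variable {ι : Type*} {l : Filter ι} {e : ι → ℂ} {Y : ι → ℂ → ℂ} {yI : ℂ → ℂ}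

theorem ApproachesOn.mono {K K' : Set ℂ} (h : ApproachesOn l e Y yI K) (hK : K' ⊆ K) :
    ApproachesOn l e Y yI K' := by
  obtain ⟨C, hC⟩ := h
  exact ⟨C, hC.mono fun i hi z hz => hi z (hK hz)⟩

theorem tendsto_pow_six_zero (he : Tendsto e l (𝓝 0)) : Tendsto (fun i => e i ^ 6) l (𝓝 0) := by
  simpa using he.pow 6

theorem approachesOn_closedBall (he : Tendsto e l (𝓝 0)) (hyI : SolvesPI yI)
    (hY : ∀ i, SolvesPII (e i) (Y i)) {a : ℂ} {R : ℝ} (hR : 0 ≤ R)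
    (hyIR : ∀ z ∈ closedBall a R, AnalyticAt ℂ yI z) (ha : ApproachesOn l e Y yI {a}) :
    ApproachesOn l e Y yI (closedBall a R) := by
  refine exists_eventually_norm_sub_le_mul (tendsto_pow_six_zero he) hR
    (F := fun x : ℂ × ℂ × ℂ => (x.2.2, 6 * x.2.1 ^ 2 + x.1))
    (H := fun x : ℂ × ℂ × ℂ => (0, 2 * x.2.1 ^ 3 + x.1 * x.2.1))
    (X := fun z => (yI z, deriv yI z)) (Y := fun i z => (Y i z, deriv (Y i) z))
    (D := fun i => {z | AnalyticAt ℂ (Y i) z})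
    (by fun_prop) (by fun_prop) ?_ ?_ (fun i => isOpen_analyticAt ℂ (Y i)) ?_ ?_
  · intro z hz
    simpa using (solvesPII_zero_iff.2 hyI).hasDerivAt_prod (hyIR z hz)
  · intro i z hz
    simpa using (hY i).hasDerivAt_prod hz
  · intro i b _ M h
    rcases eq_or_ne a b with rfl | hab
    · simpa using (h 0 ⟨le_rfl, one_pos⟩).1
    · refine (hY i).analyticAt b (meromorphicOrderAt_nonneg_of_norm_le_on_segment
        hab (M := M) fun t ht => ?_)
      exact (norm_fst_le _).trans (h t ht).2
  · obtain ⟨C, hC⟩ := ha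
    exact ⟨C, hC.mono fun i hi => hi a rfl⟩

/-- The pole-free region of `yI` is connected, because `yI` has countably many poles; hence the
approach at the initial point propagates to the whole region. -/
theorem approachesOn_singleton (he : Tendsto e l (𝓝 0)) (hyI : SolvesPI yI)
    (hY : ∀ i, SolvesPII (e i) (Y i)) {z₀ : ℂ} (hz₀ : AnalyticAt ℂ yI z₀)
    (h₀ : ApproachesOn l e Y yI {z₀}) {z : ℂ} (hz : AnalyticAt ℂ yI z) :
    ApproachesOn l e Y yI {z} := by
  have hopen := isOpen_analyticAt ℂ yI
  have hconn : IsPreconnected {z | AnalyticAt ℂ yI z} := by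
    have hm : Meromorphic yI := hyI.meromorphicAt
    have := hm.countable_compl_analyticAt.isConnected_compl_of_one_lt_rank
      (E := ℂ) (by simp)
    rw [compl_compl] at this
    exact this.isPreconnected
  have hsub := hconn.subset_of_closure_inter_subset
    (u := {z | AnalyticAt ℂ yI z ∧ ApproachesOn l e Y yI {z}}) ?_ ⟨z₀, hz₀, hz₀, h₀⟩ ?_
  · exact (hsub hz).2
  · refine isOpen_iff_mem_nhds.2 fun w hw => ?_
    obtain ⟨R, hR, hball⟩ := nhds_basis_closedBall.mem_iff.1 (hopen.mem_nhds hw.1)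
    refine mem_of_superset (closedBall_mem_nhds w hR) fun v hv => ⟨hball hv, ?_⟩
    exact (approachesOn_closedBall he hyI hY hR.le hball hw.2).mono (by simpa using hv)
  · rintro w ⟨hw, hwU⟩
    obtain ⟨R, hR, hball⟩ := nhds_basis_ball.mem_iff.1 (hopen.mem_nhds hwU)
    obtain ⟨v, hv, hvw⟩ := Metric.mem_closure_iff.1 hw (R / 2) (half_pos hR)
    refine ⟨hwU, (approachesOn_closedBall he hyI hY (half_pos hR).le (fun x hx => hball ?_)
      hv.2).mono (by simpa using hvw.le)⟩
    rw [mem_closedBall] at hx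
    rw [mem_ball]
    linarith [dist_triangle x v w, dist_comm v w]

theorem approachesOn_of_isCompact (he : Tendsto e l (𝓝 0)) (hyI : SolvesPI yI)
    (hY : ∀ i, SolvesPII (e i) (Y i)) {z₀ : ℂ} (hz₀ : AnalyticAt ℂ yI z₀)
    (h₀ : ApproachesOn l e Y yI {z₀}) {K : Set ℂ} (hK : IsCompact K)
    (hKU : ∀ z ∈ K, AnalyticAt ℂ yI z) : ApproachesOn l e Y yI K := by
  refine hK.induction_on ⟨0, by simp⟩ (fun s t hst ht => ht.mono hst) ?_ ?_
  · rintro s t ⟨C, hC⟩ ⟨C', hC'⟩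
    refine ⟨max C C', ?_⟩
    filter_upwards [hC, hC'] with i hi hi' z hz
    rcases hz with hz | hz
    · exact ⟨(hi z hz).1, (hi z hz).2.trans (by gcongr; exact le_max_left _ _)⟩
    · exact ⟨(hi' z hz).1, (hi' z hz).2.trans (by gcongr; exact le_max_right _ _)⟩
  · intro z hz
    obtain ⟨R, hR, hball⟩ :=
      nhds_basis_closedBall.mem_iff.1 ((isOpen_analyticAt ℂ yI).mem_nhds (hKU z hz))
    exact ⟨closedBall z R, mem_nhdsWithin_of_mem_nhds (closedBall_mem_nhds z hR),
      approachesOn_closedBall he hyI hY hR.le hball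
        (approachesOn_singleton he hyI hY hz₀ h₀ (hKU z hz))⟩

end Family

/-! ### The regularised system near a pole -/

theorem toMeromorphicNFOn_univ_eventuallyEq {f : ℂ → ℂ} (hf : ∀ z, MeromorphicAt f z) {z : ℂ}
    (hz : AnalyticAt ℂ f z) : toMeromorphicNFOn f Set.univ =ᶠ[𝓝 z] f :=
  ((meromorphicNFOn_toMeromorphicNFOn f Set.univ
    (Set.mem_univ z)).eventuallyEq_nhdsNE_iff_eventuallyEq_nhds hz.meromorphicNFAt).1
    (MeromorphicOn.toMeromorphicNFOn_eq_self_on_nhdsNE (fun z _ => hf z) (Set.mem_univ z))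

theorem analyticAt_toMeromorphicNFOn_univ_iff {f : ℂ → ℂ} (hf : ∀ z, MeromorphicAt f z) {z : ℂ} :
    AnalyticAt ℂ (toMeromorphicNFOn f Set.univ) z ↔ 0 ≤ meromorphicOrderAt f z := by
  rw [← (meromorphicNFOn_toMeromorphicNFOn f Set.univ
    (Set.mem_univ z)).meromorphicOrderAt_nonneg_iff_analyticAt,
    meromorphicOrderAt_toMeromorphicNFOn (fun z _ => hf z) (Set.mem_univ z)]

/-- The function `1/y`, with the correct values at the poles of `y`. -/
noncomputable def recip (y : ℂ → ℂ) : ℂ → ℂ := toMeromorphicNFOn y⁻¹ Set.univ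

/-- The energy `y'² - 4y³ - μy⁴ - 2zy - μzy²` of a solution of
`y'' = 6y² + z + μ(2y³ + zy)`, corrected by `y'/y` so as to remain finite at the poles of `y`. -/
noncomputable def rawEnergy (μ : ℂ) (y : ℂ → ℂ) (z : ℂ) : ℂ :=
  deriv y z ^ 2 - 4 * y z ^ 3 - μ * y z ^ 4 - 2 * z * y z - μ * z * y z ^ 2 + deriv y z / y z

/-- The corrected energy `rawEnergy`, with the correct values at the poles of `y`. -/
noncomputable def energy (μ : ℂ) (y : ℂ → ℂ) : ℂ → ℂ := toMeromorphicNFOn (rawEnergy μ y) Set.univ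

theorem meromorphicAt_rawEnergy (μ : ℂ) {y : ℂ → ℂ} (hy : ∀ z, MeromorphicAt y z) (z : ℂ) :
    MeromorphicAt (rawEnergy μ y) z := by
  have h := hy z
  have hid : MeromorphicAt (fun z : ℂ => z) z := MeromorphicAt.id z
  unfold rawEnergy
  fun_prop

theorem analyticAt_rawEnergy (μ : ℂ) {y : ℂ → ℂ} {z : ℂ} (hz : AnalyticAt ℂ y z) (h0 : y z ≠ 0) :
    AnalyticAt ℂ (rawEnergy μ y) z := by
  unfold rawEnergy
  fun_prop (disch := assumption)

theorem meromorphicAt_inv {y : ℂ → ℂ} (hy : ∀ z, MeromorphicAt y z) (z : ℂ) :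
    MeromorphicAt y⁻¹ z := (hy z).inv

theorem recip_eventuallyEq {y : ℂ → ℂ} (hy : ∀ z, MeromorphicAt y z) {z : ℂ}
    (hz : AnalyticAt ℂ y z) (h0 : y z ≠ 0) : recip y =ᶠ[𝓝 z] y⁻¹ :=
  toMeromorphicNFOn_univ_eventuallyEq (meromorphicAt_inv hy) (hz.inv h0)

theorem energy_eventuallyEq (μ : ℂ) {y : ℂ → ℂ} (hy : ∀ z, MeromorphicAt y z) {z : ℂ}
    (hz : AnalyticAt ℂ y z) (h0 : y z ≠ 0) : energy μ y =ᶠ[𝓝 z] rawEnergy μ y :=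
  toMeromorphicNFOn_univ_eventuallyEq (meromorphicAt_rawEnergy μ hy) (analyticAt_rawEnergy μ hz h0)

theorem deriv_recip {y : ℂ → ℂ} (hy : ∀ z, MeromorphicAt y z) {z : ℂ}
    (hz : AnalyticAt ℂ y z) (h0 : y z ≠ 0) : deriv (recip y) z = -deriv y z / y z ^ 2 := by
  rw [(recip_eventuallyEq hy hz h0).deriv_eq]
  exact (hz.differentiableAt.hasDerivAt.inv h0).deriv

/-- A solution does not vanish identically on an open set: the equation would read `0 = z`
there. -/
theorem SolvesPII.meromorphicOrderAt_ne_top {ε : ℂ} {y : ℂ → ℂ} (hy : SolvesPII ε y) (z : ℂ) :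
    meromorphicOrderAt y z ≠ ⊤ := by
  intro h
  have han : AnalyticAt ℂ y z := hy.analyticAt z (by simp [h])
  have h0 : y =ᶠ[𝓝 z] fun _ => 0 :=
    (han.continuousAt.eventuallyEq_nhds_iff_eventuallyEq_nhdsNE continuousAt_const).1
      (meromorphicOrderAt_eq_top_iff.1 h)
  have h2 : deriv (deriv y) =ᶠ[𝓝 z] fun _ => 0 := by
    have := h0.deriv.deriv
    simpa using this
  have hid : (fun w : ℂ => w) =ᶠ[𝓝 z] fun _ => 0 := by
    filter_upwards [han.eventually_analyticAt, h0, h2] with w hw hw0 hw2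
    have := hy.ode w hw
    rw [hw0, hw2] at this
    simpa using this.symm
  have := hid.deriv_eq
  simp at this

theorem SolvesPII.eventually_analyticAt_and_ne_zero {ε : ℂ} {y : ℂ → ℂ} (hy : SolvesPII ε y)
    (z : ℂ) : ∀ᶠ w in 𝓝[≠] z, AnalyticAt ℂ y w ∧ y w ≠ 0 :=
  (hy.meromorphicAt z).eventually_analyticAt.and
    ((meromorphicOrderAt_ne_top_iff_eventually_ne_zero (hy.meromorphicAt z)).1
      (hy.meromorphicOrderAt_ne_top z))

/-- The polynomial system satisfied by `u = 1/y`, `u'` and the corrected energy `V`, and the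
first integral that relates the three, away from the zeros and poles of `y`. -/
theorem SolvesPII.system_of_ne_zero {ε : ℂ} {y : ℂ → ℂ} (hy : SolvesPII ε y) {z : ℂ}
    (hz : AnalyticAt ℂ y z) (h0 : y z ≠ 0) :
    deriv (deriv (recip y)) z = 2 + ε ^ 6 * z * recip y z + 3 * z * recip y z ^ 2
        + 2 * recip y z ^ 3 * energy (ε ^ 6) y z + 2 * recip y z ^ 2 * deriv (recip y) z ∧
      deriv (energy (ε ^ 6) y) z = -z * recip y z - recip y z * deriv (recip y) z
        - energy (ε ^ 6) y z * recip y z ^ 2 ∧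
      deriv (recip y) z ^ 2 = ε ^ 6 + recip y z * (4 + (ε ^ 6 * z * recip y z
        + 2 * z * recip y z ^ 2 + recip y z ^ 3 * energy (ε ^ 6) y z
        + recip y z ^ 2 * deriv (recip y) z)) := by
  have hode := hy.ode z hz
  have hu : recip y z = (y z)⁻¹ := (recip_eventuallyEq hy.meromorphicAt hz h0).eq_of_nhds
  have hp := deriv_recip hy.meromorphicAt hz h0
  have hV : energy (ε ^ 6) y z = rawEnergy (ε ^ 6) y z :=
    (energy_eventuallyEq _ hy.meromorphicAt hz h0).eq_of_nhds
  have hy1 := hz.differentiableAt.hasDerivAt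
  have hy2 := hz.deriv.differentiableAt.hasDerivAt
  have hp' : deriv (deriv (recip y)) z
      = (-deriv (deriv y) z * y z ^ 2 - -deriv y z * (2 * y z * deriv y z)) / (y z ^ 2) ^ 2 := by
    have hev : deriv (recip y) =ᶠ[𝓝 z] fun w => -deriv y w / y w ^ 2 := by
      filter_upwards [hz.eventually_analyticAt, hz.continuousAt.eventually_ne h0] with w hw hw0
        using deriv_recip hy.meromorphicAt hw hw0
    rw [hev.deriv_eq]
    refine HasDerivAt.deriv (HasDerivAt.congr_deriv
      (hy2.neg.div (hy1.pow 2) (pow_ne_zero 2 h0)) ?_)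
    simp
  have hV' : deriv (energy (ε ^ 6) y) z
      = 2 * deriv y z * deriv (deriv y) z - 4 * (3 * y z ^ 2 * deriv y z)
        - ε ^ 6 * (4 * y z ^ 3 * deriv y z) - (2 * y z + 2 * z * deriv y z)
        - (ε ^ 6 * y z ^ 2 + ε ^ 6 * z * (2 * y z * deriv y z))
        + (deriv (deriv y) z * y z - deriv y z * deriv y z) / y z ^ 2 := by
    rw [(energy_eventuallyEq _ hy.meromorphicAt hz h0).deriv_eq]
    have hid := hasDerivAt_id z
    have := (((((hy2.pow 2).sub ((hy1.pow 3).const_mul 4)).sub ((hy1.pow 4).const_mul (ε ^ 6))).sub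
      ((hid.const_mul 2).mul hy1)).sub ((hid.const_mul (ε ^ 6)).mul (hy1.pow 2))).add
      (hy2.div hy1 h0)
    refine (this.congr_deriv ?_).deriv
    simp
  rw [hp', hV', hp, hu, hV, hode, rawEnergy]
  refine ⟨?_, ?_, ?_⟩ <;> field_simp <;> ring

/-- The points at which the system for `1/y` and the corrected energy is regular. -/
def regularSet (μ : ℂ) (y : ℂ → ℂ) : Set ℂ :=
  {z | AnalyticAt ℂ (recip y) z ∧ AnalyticAt ℂ (energy μ y) z}

theorem isOpen_regularSet (μ : ℂ) (y : ℂ → ℂ) : IsOpen (regularSet μ y) :=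
  (isOpen_analyticAt ℂ (recip y)).inter (isOpen_analyticAt ℂ (energy μ y))

theorem eq_of_eventuallyEq_nhdsNE {f g : ℂ → ℂ} {z : ℂ} (hf : ContinuousAt f z)
    (hg : ContinuousAt g z) (h : f =ᶠ[𝓝[≠] z] g) : f z = g z :=
  ((hf.eventuallyEq_nhds_iff_eventuallyEq_nhdsNE hg).1 h).eq_of_nhds

theorem SolvesPII.system_of_mem_regularSet {ε : ℂ} {y : ℂ → ℂ} (hy : SolvesPII ε y) {z : ℂ}
    (hz : z ∈ regularSet (ε ^ 6) y) :
    deriv (deriv (recip y)) z = 2 + ε ^ 6 * z * recip y z + 3 * z * recip y z ^ 2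
        + 2 * recip y z ^ 3 * energy (ε ^ 6) y z + 2 * recip y z ^ 2 * deriv (recip y) z ∧
      deriv (energy (ε ^ 6) y) z = -z * recip y z - recip y z * deriv (recip y) z
        - energy (ε ^ 6) y z * recip y z ^ 2 ∧
      deriv (recip y) z ^ 2 = ε ^ 6 + recip y z * (4 + (ε ^ 6 * z * recip y z
        + 2 * z * recip y z ^ 2 + recip y z ^ 3 * energy (ε ^ 6) y z
        + recip y z ^ 2 * deriv (recip y) z)) := by
  have hu := hz.1.continuousAt
  have hp := hz.1.deriv.continuousAt
  have hp' := hz.1.deriv.deriv.continuousAt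
  have hV := hz.2.continuousAt
  have hV' := hz.2.deriv.continuousAt
  have hev := hy.eventually_analyticAt_and_ne_zero z
  refine ⟨?_, ?_, ?_⟩
  · refine eq_of_eventuallyEq_nhdsNE hp' (g := fun z => 2 + ε ^ 6 * z * recip y z
      + 3 * z * recip y z ^ 2 + 2 * recip y z ^ 3 * energy (ε ^ 6) y z
      + 2 * recip y z ^ 2 * deriv (recip y) z) (by fun_prop) ?_
    filter_upwards [hev] with w hw using (hy.system_of_ne_zero hw.1 hw.2).1
  · refine eq_of_eventuallyEq_nhdsNE hV' (g := fun z => -z * recip y z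
      - recip y z * deriv (recip y) z - energy (ε ^ 6) y z * recip y z ^ 2) (by fun_prop) ?_
    filter_upwards [hev] with w hw using (hy.system_of_ne_zero hw.1 hw.2).2.1
  · refine eq_of_eventuallyEq_nhdsNE (f := fun z => deriv (recip y) z ^ 2)
      (g := fun z => ε ^ 6 + recip y z * (4 + (ε ^ 6 * z * recip y z
        + 2 * z * recip y z ^ 2 + recip y z ^ 3 * energy (ε ^ 6) y z
        + recip y z ^ 2 * deriv (recip y) z))) (by fun_prop) (by fun_prop) ?_
    filter_upwards [hev] with w hw using (hy.system_of_ne_zero hw.1 hw.2).2.2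

/-- At a pole of `y` both `1/y` and the corrected energy are regular. -/
theorem SolvesPII.mem_regularSet_of_order_neg {ε : ℂ} {y : ℂ → ℂ} (hy : SolvesPII ε y) {z : ℂ}
    (hz : meromorphicOrderAt y z < 0) : z ∈ regularSet (ε ^ 6) y := by
  have hu : AnalyticAt ℂ (recip y) z := by
    refine (analyticAt_toMeromorphicNFOn_univ_iff (meromorphicAt_inv hy.meromorphicAt)).2 ?_
    rw [meromorphicOrderAt_inv]
    obtain ⟨n, hn⟩ := WithTop.ne_top_iff_exists.1 (ne_top_of_lt hz)
    rw [← hn] at hz ⊢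
    have : n < 0 := by exact_mod_cast hz
    have : (0 : ℤ) ≤ -n := by omega
    exact_mod_cast this
  refine ⟨hu, ?_⟩
  have hV := meromorphicAt_rawEnergy (ε ^ 6) hy.meromorphicAt
  refine (analyticAt_toMeromorphicNFOn_univ_iff hV).2 ?_
  have hp := hu.deriv
  refine meromorphicOrderAt_nonneg_of_deriv_eq (hV z) (g := fun w => -recip y w ^ 2)
    (h := fun w => -w * recip y w - recip y w * deriv (recip y) w) (by fun_prop) (by fun_prop) ?_
  filter_upwards [hy.eventually_analyticAt_and_ne_zero z] with w hw
  have h1 := (hy.system_of_ne_zero hw.1 hw.2).2.1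
  have h2 := energy_eventuallyEq (ε ^ 6) hy.meromorphicAt hw.1 hw.2
  rw [h2.deriv_eq, h2.eq_of_nhds] at h1
  rw [h1]
  simp only [Pi.add_apply, Pi.mul_apply]
  ring

/-! ### Convergence of the regularised system -/

theorem SolvesPII.hasDerivAt_system {ε : ℂ} {y : ℂ → ℂ} (hy : SolvesPII ε y) {z : ℂ}
    (hz : z ∈ regularSet (ε ^ 6) y) :
    HasDerivAt (fun w => (recip y w, deriv (recip y) w, energy (ε ^ 6) y w))
      (deriv (recip y) z, 2 + ε ^ 6 * z * recip y z + 3 * z * recip y z ^ 2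
        + 2 * recip y z ^ 3 * energy (ε ^ 6) y z + 2 * recip y z ^ 2 * deriv (recip y) z,
        -z * recip y z - recip y z * deriv (recip y) z
        - energy (ε ^ 6) y z * recip y z ^ 2) z := by
  obtain ⟨h1, h2, -⟩ := hy.system_of_mem_regularSet hz
  rw [← h1, ← h2]
  exact hz.1.differentiableAt.hasDerivAt.prodMk
    (hz.1.deriv.differentiableAt.hasDerivAt.prodMk hz.2.differentiableAt.hasDerivAt)

section Family

variable {ι : Type*} {l : Filter ι} {e : ι → ℂ} {Y : ι → ℂ → ℂ} {yI : ℂ → ℂ}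

theorem system_approaches_at (he : Tendsto e l (𝓝 0)) (hyI : SolvesPI yI)
    (hY : ∀ i, SolvesPII (e i) (Y i)) {a : ℂ} (ha : AnalyticAt ℂ yI a) (h0 : yI a ≠ 0)
    (h : ApproachesOn l e Y yI {a}) :
    ∃ K : ℝ, ∀ᶠ i in l, a ∈ regularSet (e i ^ 6) (Y i) ∧
      ‖(recip (Y i) a, deriv (recip (Y i)) a, energy (e i ^ 6) (Y i) a)
        - (recip yI a, deriv (recip yI) a, energy 0 yI a)‖ ≤ K * ‖e i ^ 6‖ := by
  obtain ⟨C, hC⟩ := h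
  have hc := tendsto_pow_six_zero he
  let Φ : ℂ × ℂ × ℂ → ℂ × ℂ × ℂ := fun x => (x.2.1⁻¹, -x.2.2 / x.2.1 ^ 2,
    x.2.2 ^ 2 - 4 * x.2.1 ^ 3 - x.1 * x.2.1 ^ 4 - 2 * a * x.2.1 - x.1 * a * x.2.1 ^ 2
      + x.2.2 / x.2.1)
  let x₀ : ℂ × ℂ × ℂ := (0, yI a, deriv yI a)
  let x : ι → ℂ × ℂ × ℂ := fun i => (e i ^ 6, Y i a, deriv (Y i) a)
  have hΦ : DifferentiableAt ℂ Φ x₀ := by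
    have h1 : x₀.2.1 ≠ 0 := h0
    have h2 : x₀.2.1 ^ 2 ≠ 0 := pow_ne_zero 2 h0
    fun_prop (disch := assumption)
  have key : ∀ {μ : ℂ} {y : ℂ → ℂ}, (∀ z, MeromorphicAt y z) → AnalyticAt ℂ y a → y a ≠ 0 →
      (recip y a, deriv (recip y) a, energy μ y a) = Φ (μ, y a, deriv y a) := by
    intro μ y hm han hne
    rw [deriv_recip hm han hne, (recip_eventuallyEq hm han hne).eq_of_nhds,
      (energy_eventuallyEq μ hm han hne).eq_of_nhds]
    rfl
  have hx : ∀ᶠ i in l, AnalyticAt ℂ (Y i) a ∧ ‖x i - x₀‖ ≤ max 1 C * ‖e i ^ 6‖ := by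
    filter_upwards [hC] with i hi
    obtain ⟨h1, h2⟩ := hi a rfl
    refine ⟨h1, ?_⟩
    have : x i - x₀ = (e i ^ 6, (Y i a, deriv (Y i) a) - (yI a, deriv yI a)) := by simp [x, x₀]
    rw [this, Prod.norm_def]
    refine max_le ?_ (h2.trans ?_)
    · calc ‖e i ^ 6‖ = 1 * ‖e i ^ 6‖ := (one_mul _).symm
        _ ≤ _ := by gcongr; exact le_max_left _ _
    · gcongr; exact le_max_right _ _
  have hxlim : Tendsto x l (𝓝 x₀) := by
    refine tendsto_iff_norm_sub_tendsto_zero.2 ?_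
    refine squeeze_zero' (Eventually.of_forall fun _ => norm_nonneg _) (hx.mono fun i hi => hi.2) ?_
    simpa using hc.norm.const_mul (max 1 C)
  obtain ⟨B, hB0, hB⟩ := (hΦ.isBigO_sub.comp_tendsto hxlim).exists_pos
  have hne : ∀ᶠ i in l, Y i a ≠ 0 :=
    ((continuous_fst.comp continuous_snd).continuousAt.tendsto.comp hxlim).eventually_ne h0
  refine ⟨B * max 1 C, ?_⟩
  filter_upwards [hx, hne, hB.bound] with i hi hi0 hiB
  have hm := (hY i).meromorphicAt
  refine ⟨⟨(hi.1.inv hi0).congr (recip_eventuallyEq hm hi.1 hi0).symm,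
    (analyticAt_rawEnergy _ hi.1 hi0).congr (energy_eventuallyEq _ hm hi.1 hi0).symm⟩, ?_⟩
  rw [key hm hi.1 hi0, key hyI.meromorphicAt ha h0]
  calc _ ≤ B * ‖x i - x₀‖ := hiB
    _ ≤ B * (max 1 C * ‖e i ^ 6‖) := by gcongr; exact hi.2
    _ = _ := by ring

/-- On a disc around a pole of `yI`, the regularised solutions of `P_II(e i)` converge to that of
the first Painlevé equation at the rate `O(e i ^ 6)`. -/
theorem exists_system_approaches_near_pole (he : Tendsto e l (𝓝 0)) (hyI : SolvesPI yI)
    (hY : ∀ i, SolvesPII (e i) (Y i)) {z₀ : ℂ} (hz₀ : AnalyticAt ℂ yI z₀)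
    (h₀ : ApproachesOn l e Y yI {z₀}) {zhat : ℂ} (hzhat : meromorphicOrderAt yI zhat < 0) :
    ∃ ρ : ℝ, 0 < ρ ∧ ∃ K : ℝ, ∀ᶠ i in l, ∀ z ∈ closedBall zhat ρ,
      z ∈ regularSet (e i ^ 6) (Y i) ∧
      ‖(recip (Y i) z, deriv (recip (Y i)) z, energy (e i ^ 6) (Y i) z)
        - (recip yI z, deriv (recip yI) z, energy 0 yI z)‖ ≤ K * ‖e i ^ 6‖ := by
  have hyI' := solvesPII_zero_iff.2 hyI
  have hreg : zhat ∈ regularSet 0 yI := by simpa using hyI'.mem_regularSet_of_order_neg hzhat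
  obtain ⟨R, hR, hRreg⟩ := nhds_basis_closedBall.mem_iff.1
    ((isOpen_regularSet 0 yI).mem_nhds hreg)
  obtain ⟨R', hR', hRne⟩ := Metric.eventually_nhds_iff.1
    (eventually_nhdsWithin_iff.1 (hyI'.eventually_analyticAt_and_ne_zero zhat))
  obtain ⟨ρ, hρ, hρR, hρR'⟩ : ∃ ρ : ℝ, 0 < ρ ∧ 3 * ρ ≤ R ∧ ρ < R' := by
    refine ⟨min (R / 3) (R' / 2), by positivity, ?_, ?_⟩
    · linarith [min_le_left (R / 3) (R' / 2)]
    · linarith [min_le_right (R / 3) (R' / 2)]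
  let a : ℂ := zhat + ρ
  have haz : dist a zhat = ρ := by simp [a, dist_eq_norm, abs_of_pos hρ]
  obtain ⟨han, hane⟩ := hRne (y := a) (by rwa [haz]) (by
    intro h
    have : a = zhat := h
    rw [this, dist_self] at haz
    exact hρ.ne haz)
  have hbase := system_approaches_at he hyI hY han hane
    (approachesOn_singleton he hyI hY hz₀ h₀ han)
  have hsub : closedBall a (2 * ρ) ⊆ regularSet 0 yI := fun z hz => hRreg (by
    rw [mem_closedBall] at hz ⊢
    linarith [dist_triangle z a zhat])
  obtain ⟨K, hK⟩ := exists_eventually_norm_sub_le_mul (tendsto_pow_six_zero he)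
    (R := 2 * ρ) (by positivity)
    (F := fun x : ℂ × ℂ × ℂ × ℂ => (x.2.2.1, 2 + 3 * x.1 * x.2.1 ^ 2
      + 2 * x.2.1 ^ 3 * x.2.2.2 + 2 * x.2.1 ^ 2 * x.2.2.1,
      -x.1 * x.2.1 - x.2.1 * x.2.2.1 - x.2.2.2 * x.2.1 ^ 2))
    (H := fun x : ℂ × ℂ × ℂ × ℂ => (0, x.1 * x.2.1, 0))
    (X := fun z => (recip yI z, deriv (recip yI) z, energy 0 yI z))
    (Y := fun i z => (recip (Y i) z, deriv (recip (Y i)) z, energy (e i ^ 6) (Y i) z))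
    (D := fun i => regularSet (e i ^ 6) (Y i))
    (by fun_prop) (by fun_prop)
    (fun z hz => by
      have hz' : z ∈ regularSet (0 ^ 6) yI := by simpa using hsub hz
      simpa using hyI'.hasDerivAt_system hz')
    (fun i z hz => by
      refine ((hY i).hasDerivAt_system hz).congr_deriv ?_
      ext <;> simp
      ring)
    (fun i => isOpen_regularSet _ _)
    (fun i b _ M h => by
      rcases eq_or_ne a b with rfl | hab
      · simpa using (h 0 ⟨le_rfl, one_pos⟩).1
      · have hm := (hY i).meromorphicAt
        have hu := meromorphicOrderAt_nonneg_of_norm_le_on_segment (f := recip (Y i)) hab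
          fun t ht => (norm_fst_le _).trans (h t ht).2
        have hV := meromorphicOrderAt_nonneg_of_norm_le_on_segment (f := energy (e i ^ 6) (Y i))
          hab fun t ht => ((norm_snd_le _).trans (norm_snd_le _)).trans (h t ht).2
        exact ⟨(meromorphicNFOn_toMeromorphicNFOn _ _
            (Set.mem_univ b)).meromorphicOrderAt_nonneg_iff_analyticAt.1 hu,
          (meromorphicNFOn_toMeromorphicNFOn _ _
            (Set.mem_univ b)).meromorphicOrderAt_nonneg_iff_analyticAt.1 hV⟩)
    hbase
  refine ⟨ρ, hρ, K, hK.mono fun i hi z hz => hi z ?_⟩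
  rw [mem_closedBall] at hz ⊢
  linarith [dist_triangle z zhat a, dist_comm a zhat]

end Family

/-! ### Splitting of a nearly double zero -/

/-- A function with derivative close to `2` on a disc is close to the map `z ↦ 2 z`: it expands
distances by a factor near `2` and covers a neighbourhood of its value at the centre. -/
theorem expanding_and_covering_of_deriv_near_two {p p' : ℂ → ℂ} {c : ℂ} {ρ κ : ℝ} (hρ : 0 ≤ ρ)
    (hκ0 : 0 ≤ κ) (hκ : κ ≤ 1)
    (hp : ∀ z ∈ closedBall c ρ, HasDerivAt p (p' z) z)
    (hp' : ∀ z ∈ closedBall c ρ, ‖p' z - 2‖ ≤ κ) :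
    (∀ a ∈ closedBall c ρ, ∀ b ∈ closedBall c ρ, (2 - κ) * ‖a - b‖ ≤ ‖p a - p b‖) ∧
      ∀ w, ‖w - p c‖ ≤ ρ → ∃ z ∈ closedBall c ρ, p z = w := by
  have hlip : ∀ a ∈ closedBall c ρ, ∀ b ∈ closedBall c ρ,
      ‖p a - p b - 2 * (a - b)‖ ≤ κ * ‖a - b‖ := by
    intro a ha b hb
    have := (convex_closedBall c ρ).norm_image_sub_le_of_norm_hasDerivWithin_le
      (f := fun z => p z - 2 * z) (f' := fun z => p' z - 2 * 1) (C := κ)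
      (fun z hz => ((hp z hz).sub ((hasDerivAt_id z).const_mul 2)).hasDerivWithinAt)
      (fun z hz => by simpa using hp' z hz) hb ha
    calc _ = ‖p a - 2 * a - (p b - 2 * b)‖ := by congr 1; ring
      _ ≤ _ := this
  refine ⟨fun a ha b hb => ?_, fun w hw => ?_⟩
  · have h1 := hlip a ha b hb
    have h2 : ‖2 * (a - b)‖ ≤ ‖p a - p b‖ + ‖p a - p b - 2 * (a - b)‖ := by
      calc ‖2 * (a - b)‖ = ‖(p a - p b) - (p a - p b - 2 * (a - b))‖ := by congr 1; ring
        _ ≤ _ := norm_sub_le _ _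
    rw [norm_mul, Complex.norm_ofNat] at h2
    linarith
  · lift κ to NNReal using hκ0
    have happrox : ApproximatesLinearOn p ((2 : ℂ) • ContinuousLinearMap.id ℂ ℂ)
        (closedBall c ρ) κ := fun a ha b hb => by
      simpa [smul_eq_mul] using hlip a ha b hb
    let inv : ((2 : ℂ) • ContinuousLinearMap.id ℂ ℂ).NonlinearRightInverse :=
      { toFun := fun z => z / 2
        nnnorm := 1 / 2
        bound' := fun z => by simp [div_eq_inv_mul]
        right_inv' := fun z => by simp; ring }
    have hsurj := happrox.surjOn_closedBall_of_nonlinearRightInverse inv hρ subset_rfl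
    refine hsurj (mem_closedBall_iff_norm.2 (hw.trans ?_))
    have : ((inv.nnnorm : ℝ)⁻¹ - (κ : ℝ)) = 2 - κ := by
      simp [inv]
    rw [this]
    nlinarith

/-- The splitting of a nearly double zero of `u`, where `u'' ≈ 2` and
`u'² = ε⁶ + u (4 + small)`. By the latter relation the zeros of `u` are precisely the points
where `u' = ± ε³`, and `u'` is injective. -/
theorem exists_zeros_of_nearly_double_zero {u h : ℂ → ℂ} {c ε : ℂ} {ρ κ : ℝ}
    (hκ0 : 0 ≤ κ) (hκ : κ ≤ 1 / 2) (hε : ε ≠ 0) (hρ : 4 * ‖ε‖ ^ 3 ≤ ρ)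
    (hu : ∀ z ∈ closedBall c ρ, AnalyticAt ℂ u z)
    (hp : ∀ z ∈ closedBall c ρ, ‖deriv (deriv u) z - 2‖ ≤ κ)
    (hI : ∀ z ∈ closedBall c ρ, deriv u z ^ 2 = ε ^ 6 + u z * (4 + h z))
    (hh : ∀ z ∈ closedBall c ρ, ‖h z‖ ≤ κ) (hc : ‖deriv u c‖ ≤ ‖ε‖ ^ 3) :
    ∃ zp ∈ ball c ρ, ∃ zm ∈ ball c ρ, ∃ z₁ ∈ ball c ρ,
      (deriv u zp = ε ^ 3 ∧ u zp = 0) ∧ (deriv u zm = -ε ^ 3 ∧ u zm = 0) ∧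
      (deriv u z₁ = 0 ∧ u z₁ * (4 + h z₁) = -ε ^ 6) ∧
      (∀ z ∈ closedBall c ρ, u z = 0 → z = zp ∨ z = zm) ∧
      (∀ z ∈ closedBall c ρ, deriv u z = 0 → z = z₁) ∧
      (2 - κ) * ‖zp - zm‖ ≤ 2 * ‖ε‖ ^ 3 ∧
      ‖zp - c‖ ≤ 2 * ‖ε‖ ^ 3 ∧ ‖zm - c‖ ≤ 2 * ‖ε‖ ^ 3 := by
  have hε3 : 0 < ‖ε‖ ^ 3 := by positivity
  have hρ0 : 0 < ρ := by linarith
  obtain ⟨hexp, hcov⟩ := expanding_and_covering_of_deriv_near_two hρ0.le hκ0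
    (by linarith) (fun z hz => (hu z hz).deriv.differentiableAt.hasDerivAt) hp
  have hcb : c ∈ closedBall c ρ := mem_closedBall_self hρ0.le
  have hsolve : ∀ w, ‖w‖ ≤ ‖ε‖ ^ 3 →
      ∃ z ∈ closedBall c ρ, deriv u z = w ∧ ‖z - c‖ ≤ 2 * ‖ε‖ ^ 3 := by
    intro w hw
    have hwc : ‖w - deriv u c‖ ≤ 2 * ‖ε‖ ^ 3 := by
      linarith [norm_sub_le w (deriv u c)]
    obtain ⟨z, hz, hzw⟩ := hcov w (by linarith)
    refine ⟨z, hz, hzw, ?_⟩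
    have := hexp z hz c hcb
    rw [hzw] at this
    nlinarith [norm_nonneg (z - c)]
  have hball : ∀ z, ‖z - c‖ ≤ 2 * ‖ε‖ ^ 3 → z ∈ ball c ρ := fun z hz => by
    rw [mem_ball_iff_norm]; linarith
  have hinj : ∀ a ∈ closedBall c ρ, ∀ b ∈ closedBall c ρ, deriv u a = deriv u b → a = b := by
    intro a ha b hb hab
    have := hexp a ha b hb
    rw [hab, sub_self, norm_zero] at this
    have h0 : ‖a - b‖ ≤ 0 := by nlinarith [norm_nonneg (a - b)]
    exact sub_eq_zero.1 (norm_le_zero_iff.1 h0)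
  have hzero : ∀ z ∈ closedBall c ρ, deriv u z ^ 2 = ε ^ 6 → u z = 0 := by
    intro z hz h2
    have h3 := hI z hz
    rw [h2] at h3
    have h4 : u z * (4 + h z) = 0 := by linear_combination -h3
    refine (mul_eq_zero.1 h4).resolve_right fun h5 => ?_
    have h6 := hh z hz
    rw [(by linear_combination h5 : h z = -4), norm_neg, Complex.norm_ofNat] at h6
    linarith
  obtain ⟨zp, hzp, hpp, hpc⟩ := hsolve (ε ^ 3) (by rw [norm_pow])
  obtain ⟨zm, hzm, hmp, hmc⟩ := hsolve (-ε ^ 3) (by rw [norm_neg, norm_pow])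
  obtain ⟨z₁, hz₁, h1p, h1c⟩ := hsolve 0 (by rw [norm_zero]; exact hε3.le)
  refine ⟨zp, hball _ hpc, zm, hball _ hmc, z₁, hball _ h1c, ⟨hpp, hzero _ hzp ?_⟩,
    ⟨hmp, hzero _ hzm ?_⟩, ⟨h1p, ?_⟩, fun z hz hz0 => ?_, fun z hz hz0 => ?_, ?_, hpc, hmc⟩
  · rw [hpp]; ring
  · rw [hmp]; ring
  · have := hI z₁ hz₁
    rw [h1p] at this
    linear_combination -this
  · have h2 := hI z hz
    rw [hz0] at h2
    have h3 : (deriv u z - ε ^ 3) * (deriv u z + ε ^ 3) = 0 := by linear_combination h2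
    rcases mul_eq_zero.1 h3 with h4 | h4
    · exact Or.inl (hinj z hz zp hzp (by rw [hpp]; linear_combination h4))
    · exact Or.inr (hinj z hz zm hzm (by rw [hmp]; linear_combination h4))
  · exact hinj z hz z₁ hz₁ (by rw [hz0, h1p])
  · have := hexp zp hzp zm hzm
    rw [hpp, hmp] at this
    refine this.trans_eq ?_
    rw [show ε ^ 3 - -ε ^ 3 = 2 * ε ^ 3 by ring, norm_mul, Complex.norm_ofNat, norm_pow]

/-! ### Poles and stationary points in terms of the reciprocal -/

theorem isPole_iff_recip_eq_zero {ε : ℂ} {y : ℂ → ℂ} (hy : SolvesPII ε y) {z : ℂ}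
    (hz : AnalyticAt ℂ (recip y) z) : IsPole y z ↔ recip y z = 0 := by
  have hm := meromorphicAt_inv hy.meromorphicAt
  have hord : meromorphicOrderAt (recip y) z = -meromorphicOrderAt y z := by
    rw [recip, meromorphicOrderAt_toMeromorphicNFOn (fun z _ => hm z) (Set.mem_univ z),
      meromorphicOrderAt_inv]
  have h0 := hz.meromorphicOrderAt_nonneg
  have hne := hz.meromorphicNFAt.meromorphicOrderAt_eq_zero_iff
  obtain ⟨n, hn⟩ := WithTop.ne_top_iff_exists.1 (hy.meromorphicOrderAt_ne_top z)
  rw [hord, ← hn] at h0 hne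
  have h0' : 0 ≤ -n := by exact_mod_cast h0
  have hne' : -n = 0 ↔ recip y z ≠ 0 := by rw [← hne]; norm_cast
  rw [IsPole, and_iff_right (hy.meromorphicAt z), ← hn, ← not_iff_not, ← ne_eq, ← hne']
  have : ((n : WithTop ℤ) < 0) ↔ n < 0 := by norm_cast
  rw [this]
  omega

theorem analyticAt_and_ne_zero_of_recip_ne_zero {ε : ℂ} {y : ℂ → ℂ} (hy : SolvesPII ε y) {z : ℂ}
    (hz : AnalyticAt ℂ (recip y) z) (h0 : recip y z ≠ 0) : AnalyticAt ℂ y z ∧ y z ≠ 0 := by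
  have hpole := (isPole_iff_recip_eq_zero hy hz).not.2 h0
  have han : AnalyticAt ℂ y z :=
    hy.analyticAt z (not_lt.1 fun h => hpole ⟨hy.meromorphicAt z, h⟩)
  refine ⟨han, fun hyz => ?_⟩
  -- on a punctured neighbourhood `recip y * y = 1`, which persists at `z` by continuity
  have h1 : recip y z * y z = 1 := by
    refine eq_of_eventuallyEq_nhdsNE (f := fun w => recip y w * y w) (g := fun _ => 1)
      (hz.continuousAt.mul han.continuousAt) continuousAt_const ?_
    filter_upwards [hy.eventually_analyticAt_and_ne_zero z] with w hw
    rw [(recip_eventuallyEq hy.meromorphicAt hw.1 hw.2).eq_of_nhds, Pi.inv_apply,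
      inv_mul_cancel₀ hw.2]
  rw [hyz, mul_zero] at h1
  exact zero_ne_one h1

theorem ne_zero_of_analyticAt_recip {ε : ℂ} {y : ℂ → ℂ} (hy : SolvesPII ε y) {z : ℂ}
    (hz : AnalyticAt ℂ (recip y) z) (han : AnalyticAt ℂ y z) : y z ≠ 0 :=
  (analyticAt_and_ne_zero_of_recip_ne_zero hy hz fun h0 =>
    not_lt.2 han.meromorphicOrderAt_nonneg ((isPole_iff_recip_eq_zero hy hz).2 h0).2).2

theorem isStationaryPoint_iff_of_analyticAt_recip {ε : ℂ} {y : ℂ → ℂ} (hy : SolvesPII ε y) {z : ℂ}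
    (hz : AnalyticAt ℂ (recip y) z) :
    IsStationaryPoint y z ↔ recip y z ≠ 0 ∧ deriv (recip y) z = 0 := by
  constructor
  · rintro ⟨han, hd⟩
    have h0 := ne_zero_of_analyticAt_recip hy hz han
    refine ⟨?_, by rw [deriv_recip hy.meromorphicAt han h0, hd]; simp⟩
    rw [(recip_eventuallyEq hy.meromorphicAt han h0).eq_of_nhds]
    exact inv_ne_zero h0
  · rintro ⟨h0, hd⟩
    obtain ⟨han, hy0⟩ := analyticAt_and_ne_zero_of_recip_ne_zero hy hz h0
    rw [deriv_recip hy.meromorphicAt han hy0] at hd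
    refine ⟨han, ?_⟩
    rcases div_eq_zero_iff.1 hd with h | h
    · exact neg_eq_zero.1 h
    · exact absurd h (pow_ne_zero 2 hy0)

theorem isSimplePoleWithResidue_of_deriv_recip {ε : ℂ} {y : ℂ → ℂ} (hy : SolvesPII ε y) {z d : ℂ}
    (hz : AnalyticAt ℂ (recip y) z) (h0 : recip y z = 0) (hd : deriv (recip y) z = d)
    (hd0 : d ≠ 0) : IsSimplePoleWithResidue y z d⁻¹ := by
  have hlim : Tendsto (fun w => (w - z) * y w) (𝓝[≠] z) (𝓝 d⁻¹) := by
    have hs := (hasDerivAt_iff_tendsto_slope.1 hz.differentiableAt.hasDerivAt).inv₀ (hd ▸ hd0)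
    rw [hd] at hs
    refine hs.congr' ?_
    filter_upwards [hy.eventually_analyticAt_and_ne_zero z] with w hw
    rw [slope_def_field, h0, (recip_eventuallyEq hy.meromorphicAt hw.1 hw.2).eq_of_nhds]
    simp [div_eq_mul_inv, mul_comm]
  refine ⟨hy.meromorphicAt z, ?_, hlim⟩
  have hm : MeromorphicAt (fun w => w - z) z := by fun_prop
  have h1 : meromorphicOrderAt (fun w => (w - z) * y w) z = 0 :=
    (tendsto_ne_zero_iff_meromorphicOrderAt_eq_zero (hm.mul (hy.meromorphicAt z))).1
      ⟨d⁻¹, inv_ne_zero hd0, hlim⟩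
  rw [fun_meromorphicOrderAt_mul hm (hy.meromorphicAt z)] at h1
  have h2 : meromorphicOrderAt (fun w => w - z) z = 1 := by simp
  rw [h2] at h1
  obtain ⟨n, hn⟩ := WithTop.ne_top_iff_exists.1 (hy.meromorphicOrderAt_ne_top z)
  rw [← hn] at h1 ⊢
  have h3 : 1 + n = 0 := by exact_mod_cast h1
  have : n = -1 := by omega
  rw [this]; rfl

/-! ### Coalescence of the poles -/

section Family

variable {ι : Type*} {l : Filter ι} {e : ι → ℂ} {Y : ι → ℂ → ℂ} {yI : ℂ → ℂ}

/-- Near a pole `zhat` of `yI`, the coefficients `u''` and `(u'² - ε⁶) / u` of the regularised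
system are eventually as close to `2` and `4` as desired, and `u'(zhat) = O(ε⁶)` is dominated
by `|ε|³`. -/
theorem exists_eventually_nearly_double_zero (he : Tendsto e l (𝓝 0)) (hyI : SolvesPI yI)
    (hY : ∀ i, SolvesPII (e i) (Y i)) {z₀ : ℂ} (hz₀ : AnalyticAt ℂ yI z₀)
    (h₀ : ApproachesOn l e Y yI {z₀}) {zhat : ℂ} (hzhat : meromorphicOrderAt yI zhat < 0)
    {δ κ : ℝ} (hδ : 0 < δ) (hκ : 0 < κ) :
    ∃ ρ : ℝ, 0 < ρ ∧ ρ ≤ δ ∧ ∃ h : ι → ℂ → ℂ, ∀ᶠ i in l, ‖deriv (recip (Y i)) zhat‖ ≤ ‖e i‖ ^ 3 ∧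
      ∀ z ∈ closedBall zhat ρ, AnalyticAt ℂ (recip (Y i)) z ∧
        ‖deriv (deriv (recip (Y i))) z - 2‖ ≤ κ ∧
        deriv (recip (Y i)) z ^ 2 = e i ^ 6 + recip (Y i) z * (4 + h i z) ∧ ‖h i z‖ ≤ κ := by
  obtain ⟨ρ₀, hρ₀, K, hK⟩ := exists_system_approaches_near_pole he hyI hY hz₀ h₀ hzhat
  have hyI' := solvesPII_zero_iff.2 hyI
  have hreg : zhat ∈ regularSet (0 ^ 6) yI := hyI'.mem_regularSet_of_order_neg hzhat
  have hu0 : recip yI zhat = 0 :=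
    (isPole_iff_recip_eq_zero hyI' hreg.1).1 ⟨hyI.meromorphicAt zhat, hzhat⟩
  have hp0 : deriv (recip yI) zhat = 0 := by
    have := (hyI'.system_of_mem_regularSet hreg).2.2
    rw [hu0] at this
    simpa using this
  let X : ℂ → ℂ × ℂ × ℂ := fun z => (recip yI z, deriv (recip yI) z, energy 0 yI z)
  have hX : ContinuousAt X zhat := by
    have := (hyI'.hasDerivAt_system hreg).continuousAt
    simpa using this
  -- `u'' - 2` and the factor `h` of the first integral as functions of `(μ, z, u, u', V)`;
  -- both vanish for `u = 0`
  let g₁ : ℂ × ℂ × ℂ × ℂ × ℂ → ℂ := fun x => x.1 * x.2.1 * x.2.2.1 + 3 * x.2.1 * x.2.2.1 ^ 2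
    + 2 * x.2.2.1 ^ 3 * x.2.2.2.2 + 2 * x.2.2.1 ^ 2 * x.2.2.2.1
  let g₂ : ℂ × ℂ × ℂ × ℂ × ℂ → ℂ := fun x => x.1 * x.2.1 * x.2.2.1 + 2 * x.2.1 * x.2.2.1 ^ 2
    + x.2.2.1 ^ 3 * x.2.2.2.2 + x.2.2.1 ^ 2 * x.2.2.2.1
  let x₀ : ℂ × ℂ × ℂ × ℂ × ℂ := (0, zhat, X zhat)
  have hg₁ : ContinuousAt (fun x => ‖g₁ x‖) x₀ := by fun_prop
  have hg₂ : ContinuousAt (fun x => ‖g₂ x‖) x₀ := by fun_prop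
  obtain ⟨τ, hτ, hτg⟩ := Metric.eventually_nhds_iff.1
    ((hg₁.eventually_lt (continuousAt_const (y := κ)) (by simpa [g₁, x₀, X, hu0] using hκ)).and
      (hg₂.eventually_lt (continuousAt_const (y := κ)) (by simpa [g₂, x₀, X, hu0] using hκ)))
  obtain ⟨ρ₁, hρ₁, hρ₁X⟩ := Metric.continuousAt_iff.1 hX (τ / 2) (half_pos hτ)
  obtain ⟨ρ, hρ, hρδ, hρ0, hρ1, hρτ⟩ : ∃ ρ : ℝ, 0 < ρ ∧ ρ ≤ δ ∧ ρ ≤ ρ₀ ∧ ρ < ρ₁ ∧ ρ < τ := by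
    refine ⟨min (min δ ρ₀) (min (ρ₁ / 2) (τ / 2)), by positivity,
      (min_le_left _ _).trans (min_le_left _ _), (min_le_left _ _).trans (min_le_right _ _),
      ?_, ?_⟩
    · exact ((min_le_right _ _).trans (min_le_left _ _)).trans_lt (half_lt_self hρ₁)
    · exact ((min_le_right _ _).trans (min_le_right _ _)).trans_lt (half_lt_self hτ)
  have hc := tendsto_pow_six_zero he
  have hlt : ∀ {a : ℝ}, 0 < a → ∀ᶠ i in l, ‖e i ^ 6‖ < a ∧ K * ‖e i ^ 6‖ < a ∧
      K * ‖e i‖ ^ 3 < 1 := by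
    intro a ha
    have h1 : Tendsto (fun i => ‖e i ^ 6‖) l (𝓝 0) := by simpa using hc.norm
    have h2 : Tendsto (fun i => K * ‖e i ^ 6‖) l (𝓝 0) := by simpa using h1.const_mul K
    have h3 : Tendsto (fun i => K * ‖e i‖ ^ 3) l (𝓝 0) := by
      simpa using (he.norm.pow 3).const_mul K
    exact (h1.eventually_lt_const ha).and
      ((h2.eventually_lt_const ha).and (h3.eventually_lt_const one_pos))
  refine ⟨ρ, hρ, hρδ, fun i z => g₂ (e i ^ 6, z, recip (Y i) z, deriv (recip (Y i)) z,
    energy (e i ^ 6) (Y i) z), ?_⟩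
  filter_upwards [hK, hlt (half_pos hτ)] with i hi hi2
  obtain ⟨hi2, hi3, hi4⟩ := hi2
  refine ⟨?_, fun z hz => ?_⟩
  · have h1 := (hi zhat (mem_closedBall_self hρ₀.le)).2
    have h2 := ((norm_fst_le _).trans (norm_snd_le _)).trans h1
    simp only [Prod.snd_sub, Prod.fst_sub, hp0, sub_zero] at h2
    refine h2.trans ?_
    rw [norm_pow]
    nlinarith [pow_nonneg (norm_nonneg (e i)) 3]
  · have hz0 := closedBall_subset_closedBall hρ0 hz
    obtain ⟨hzreg, hzX⟩ := hi z hz0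
    obtain ⟨e1, -, e3⟩ := (hY i).system_of_mem_regularSet hzreg
    have hdist : dist (e i ^ 6, z, recip (Y i) z, deriv (recip (Y i)) z,
        energy (e i ^ 6) (Y i) z) x₀ < τ := by
      rw [mem_closedBall] at hz
      have h1 := hρ₁X (hz.trans_lt hρ1)
      have h2 := dist_triangle (recip (Y i) z, deriv (recip (Y i)) z, energy (e i ^ 6) (Y i) z)
        (X z) (X zhat)
      rw [dist_eq_norm _ (X z)] at h2
      have h3 : dist (recip (Y i) z, deriv (recip (Y i)) z, energy (e i ^ 6) (Y i) z)
          (X zhat) < τ := by linarith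
      rw [Prod.dist_eq, Prod.dist_eq]
      refine max_lt ?_ (max_lt (hz.trans_lt hρτ) h3)
      simp only [x₀, dist_zero_right]
      linarith
    obtain ⟨hs1, hs2⟩ := hτg hdist
    refine ⟨hzreg.1, ?_, e3, hs2.le⟩
    rw [e1]
    refine le_trans (le_of_eq ?_) hs1.le
    simp only [g₁]
    congr 1
    ring

end Family

/-- The numerical part of the estimates: if `u (4 + h) = -ε⁶` with `|h| ≤ κ`, then `A = 1/|u|` is
`4 |ε|⁻⁶` up to the relative error `κ / 4`, and a distance `d` with `(2 - κ) d ≤ 2 |ε|³` is at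
most `4 / (ν A |ε|³)` as soon as `κ ≤ 1 - ν`. -/
theorem amplitude_and_distance_estimates {ε u h : ℂ} {κ ν d : ℝ} (hε : ε ≠ 0)
    (hκ0 : 0 ≤ κ) (hκ : κ ≤ 1 / 2)
    (hν : 0 < ν) (hκν : κ ≤ 1 - ν) (hh : ‖h‖ ≤ κ) (hu : u * (4 + h) = -ε ^ 6)
    (hd : (2 - κ) * d ≤ 2 * ‖ε‖ ^ 3) :
    |‖u⁻¹‖ / (4 * (‖ε‖ ^ 6)⁻¹) - 1| ≤ κ ∧ d ≤ 4 / (ν * ‖u⁻¹‖ * ‖ε‖ ^ 3) := by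
  have hε0 : 0 < ‖ε‖ := norm_pos_iff.2 hε
  have hu0 : u ≠ 0 := by
    rintro rfl
    rw [zero_mul] at hu
    exact pow_ne_zero 6 hε (neg_eq_zero.1 hu.symm)
  have hn : ‖u‖ * ‖4 + h‖ = ‖ε‖ ^ 6 := by rw [← norm_mul, hu, norm_neg, norm_pow]
  have hA : ‖u⁻¹‖ = ‖4 + h‖ / ‖ε‖ ^ 6 := by
    rw [norm_inv, ← hn]
    have := norm_ne_zero_iff.2 hu0
    have h4 : ‖4 + h‖ ≠ 0 := fun h4 => by
      rw [h4, mul_zero] at hn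
      exact (pow_pos hε0 6).ne hn
    field_simp
  have h1 : ‖4 + h‖ ≤ 4 + κ := by
    refine (norm_add_le _ _).trans ?_
    rw [Complex.norm_ofNat]
    linarith
  have h2 : 4 - κ ≤ ‖4 + h‖ := by
    have := norm_sub_le (4 + h) h
    rw [add_sub_cancel_right, Complex.norm_ofNat] at this
    linarith
  have h4pos : 0 < ‖4 + h‖ := by linarith
  constructor
  · have : ‖u⁻¹‖ / (4 * (‖ε‖ ^ 6)⁻¹) = ‖4 + h‖ / 4 := by
      rw [hA]
      field_simp
    rw [this, abs_le]
    constructor <;> linarith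
  · have : 4 / (ν * ‖u⁻¹‖ * ‖ε‖ ^ 3) = 4 * ‖ε‖ ^ 3 / (ν * ‖4 + h‖) := by
      rw [hA]
      field_simp
    rw [this, le_div_iff₀ (by positivity)]
    have hε3 : 0 < ‖ε‖ ^ 3 := by positivity
    have h3 : ν * ‖4 + h‖ ≤ 2 * (2 - κ) := by nlinarith
    rcases le_or_gt d 0 with hd0 | hd0
    · have : d * (ν * ‖4 + h‖) ≤ 0 := mul_nonpos_of_nonpos_of_nonneg hd0 (by positivity)
      linarith
    · calc d * (ν * ‖4 + h‖) ≤ d * (2 * (2 - κ)) := by gcongr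
        _ = 2 * ((2 - κ) * d) := by ring
        _ ≤ 4 * ‖ε‖ ^ 3 := by linarith

theorem mainTheorem3
    (z₀ α β : ℂ)
    (yI : ℂ → ℂ) (hyI : SolvesPI yI) (hyI₀ : HasInitialData yI z₀ α β)
    (zhat : ℂ) (hzhat : meromorphicOrderAt yI zhat = -2) :
    ∃ C : ℝ, 0 < C ∧
      ∀ δ : ℝ, 0 < δ →
      (∀ z ∈ closedBall zhat δ, z ≠ zhat → AnalyticAt ℂ yI z ∧ deriv yI z ≠ 0) →
      ∀ ν : ℝ, 0 < ν → ν < 1 →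
      ∀ η : ℝ, 0 < η →
      ∃ r : ℝ, 0 < r ∧
        ∀ ε : ℂ, 0 < ‖ε‖ → ‖ε‖ < r →
        ∀ y : ℂ → ℂ, SolvesPII ε y → HasInitialData y z₀ α β →
        ∃ zp zm z₁ : ℂ,
          -- the poles of `y` near `zhat` are exactly two simple ones, of opposite residues
          zp ≠ zm ∧
          {z | z ∈ ball zhat δ ∧ IsPole y z} = {zp, zm} ∧
          IsSimplePoleWithResidue y zp ((ε ^ 3)⁻¹) ∧
          IsSimplePoleWithResidue y zm (-(ε ^ 3)⁻¹) ∧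
          -- `z₁` is the only stationary point of `y` near `zhat`, and `A = ‖y z₁‖`
          {z | z ∈ ball zhat δ ∧ IsStationaryPoint y z} = {z₁} ∧
          -- `A` is asymptotic to `4 |ε|⁻⁶`
          |‖y z₁‖ / (4 * (‖ε‖ ^ 6)⁻¹) - 1| ≤ η ∧
          -- the estimate, and the rate
          ‖zp - zm‖ ≤ 4 / (ν * ‖y z₁‖ * ‖ε‖ ^ 3) ∧
          ‖zp - zm‖ ≤ C * ‖ε‖ ^ 3 ∧
          ‖zp - zhat‖ ≤ C * ‖ε‖ ^ 3 ∧
          ‖zm - zhat‖ ≤ C * ‖ε‖ ^ 3 := by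
  -- with `p = (1/y)'`, the distances to `zhat` are bounded by `‖p(z±) - p(zhat)‖ ≤ 2 ‖ε‖ ^ 3`,
  -- because `|p' - 2| ≤ 1 / 2`
  refine ⟨2, two_pos, fun δ hδ hδI ν hν hν1 η hη => ?_⟩
  -- the family of all solutions with the given initial data, filtered by `ε → 0`
  let ι : Type := {q : ℂ × (ℂ → ℂ) // SolvesPII q.1 q.2 ∧ HasInitialData q.2 z₀ α β}
  let e : ι → ℂ := fun q => q.1.1
  let Y : ι → ℂ → ℂ := fun q => q.1.2
  let l : Filter ι := comap e (𝓝 0)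
  have he : Tendsto e l (𝓝 0) := tendsto_comap
  have hY : ∀ i, SolvesPII (e i) (Y i) := fun i => i.2.1
  have h₀ : ApproachesOn l e Y yI {z₀} := by
    refine ⟨0, Eventually.of_forall fun i z hz => ?_⟩
    rw [Set.mem_singleton_iff.1 hz]
    obtain ⟨h1, h2, h3⟩ := i.2.2
    refine ⟨h1, ?_⟩
    simp [Y, h2, h3, hyI₀.2.1, hyI₀.2.2]
  have hneg : meromorphicOrderAt yI zhat < 0 := by rw [hzhat]; decide
  -- the tolerance for `u'' ≈ 2` and `(u'² - ε⁶) / u ≈ 4` that the choice of `ν` and `η` demands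
  let κ : ℝ := min (1 / 2) (min (1 - ν) η)
  have hκ : 0 < κ := lt_min (by norm_num) (lt_min (by linarith) hη)
  have hκ2 : κ ≤ 1 / 2 := min_le_left _ _
  have hκν : κ ≤ 1 - ν := (min_le_right _ _).trans (min_le_left _ _)
  have hκη : κ ≤ η := (min_le_right _ _).trans (min_le_right _ _)
  obtain ⟨ρ, hρ, hρδ, h, hloc⟩ := exists_eventually_nearly_double_zero he hyI hY hyI₀.1 h₀ hneg
    hδ hκ
  -- the closed annulus between the radii `ρ` and `δ`
  let K : Set ℂ := closedBall zhat δ \ ball zhat ρ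
  have hKc : IsCompact K := (isCompact_closedBall zhat δ).diff isOpen_ball
  have hKI : ∀ z ∈ K, AnalyticAt ℂ yI z ∧ deriv yI z ≠ 0 := fun z hz => hδI z hz.1 (by
    rintro rfl
    exact hz.2 (mem_ball_self hρ))
  obtain ⟨C, hC⟩ := approachesOn_of_isCompact he hyI hY hyI₀.1 h₀ hKc fun z hz => (hKI z hz).1
  obtain ⟨m, hm, hmK⟩ : ∃ m : ℝ, 0 < m ∧ ∀ z ∈ K, m ≤ ‖deriv yI z‖ := by
    have hcont : ContinuousOn (fun z => ‖deriv yI z‖) K :=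
      fun z hz => (hKI z hz).1.deriv.continuousAt.norm.continuousWithinAt
    rcases K.eq_empty_or_nonempty with hK | hK
    · exact ⟨1, one_pos, by simp [hK]⟩
    · obtain ⟨w, hw, hwmin⟩ := hKc.exists_isMinOn hK hcont
      exact ⟨‖deriv yI w‖, norm_pos_iff.2 (hKI w hw).2, fun z hz => hwmin hz⟩
  have hsmall : ∀ᶠ i in l, C * ‖e i ^ 6‖ < m ∧ 4 * ‖e i‖ ^ 3 < ρ := by
    have h1 : Tendsto (fun i => C * ‖e i ^ 6‖) l (𝓝 0) := by
      simpa using (tendsto_pow_six_zero he).norm.const_mul C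
    have h2 : Tendsto (fun i => 4 * ‖e i‖ ^ 3) l (𝓝 0) := by
      simpa using (he.norm.pow 3).const_mul 4
    exact (h1.eventually_lt_const hm).and (h2.eventually_lt_const hρ)
  obtain ⟨r, hr, hrl⟩ := Metric.eventually_nhds_iff.1
    (eventually_comap.1 (hloc.and (hC.and hsmall)))
  refine ⟨r, hr, fun ε hε0 hεr y hy hy₀ => ?_⟩
  have hε : ε ≠ 0 := norm_pos_iff.1 hε0
  obtain ⟨⟨hc, hloc⟩, hCK, hCm, hερ⟩ := hrl (by simpa using hεr) (⟨(ε, y), hy, hy₀⟩ : ι) rfl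
  simp only [e, Y] at hc hloc hCK hCm hερ
  obtain ⟨zp, hzp, zm, hzm, z₁, hz₁, ⟨hpp, hup⟩, ⟨hmp, hum⟩, ⟨h1p, hu1⟩, hzero, hstat, hdist,
    hpc, hmc⟩ := exists_zeros_of_nearly_double_zero hκ.le hκ2 hε hερ.le
      (fun z hz => (hloc z hz).1) (fun z hz => (hloc z hz).2.1) (fun z hz => (hloc z hz).2.2.1)
      (fun z hz => (hloc z hz).2.2.2) hc
  have han : ∀ z ∈ ball zhat ρ, AnalyticAt ℂ (recip y) z :=
    fun z hz => (hloc z (ball_subset_closedBall hz)).1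
  have hε3 : ε ^ 3 ≠ 0 := pow_ne_zero 3 hε
  have hball : ball zhat ρ ⊆ ball zhat δ := ball_subset_ball hρδ
  have houter : ∀ z ∈ ball zhat δ, z ∉ ball zhat ρ → AnalyticAt ℂ y z ∧ deriv y z ≠ 0 := by
    intro z hz hzρ
    have hzK : z ∈ K := ⟨ball_subset_closedBall hz, hzρ⟩
    obtain ⟨h1, h2⟩ := hCK z hzK
    refine ⟨h1, fun h3 => ?_⟩
    have h4 := (norm_snd_le _).trans h2
    simp only [Prod.snd_sub, h3, zero_sub, norm_neg] at h4
    linarith [hmK z hzK]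
  have hu1ne : recip y z₁ ≠ 0 := by
    intro h0
    rw [h0, zero_mul] at hu1
    exact pow_ne_zero 6 hε (neg_eq_zero.1 hu1.symm)
  obtain ⟨hy1, hy1ne⟩ := analyticAt_and_ne_zero_of_recip_ne_zero hy (han z₁ hz₁) hu1ne
  have hyu : y z₁ = (recip y z₁)⁻¹ := by
    rw [(recip_eventuallyEq hy.meromorphicAt hy1 hy1ne).eq_of_nhds, Pi.inv_apply, inv_inv]
  obtain ⟨hA, hd⟩ := amplitude_and_distance_estimates hε hκ.le hκ2 hν hκν
    (hloc z₁ (ball_subset_closedBall hz₁)).2.2.2 hu1 hdist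
  refine ⟨zp, zm, z₁, ?_, ?_, ?_, ?_, ?_, ?_, ?_, ?_, hpc, hmc⟩
  · rintro rfl
    rw [hpp] at hmp
    exact hε3 (self_eq_neg.1 hmp)
  · ext z
    simp only [Set.mem_ofPred_eq, Set.mem_insert_iff, Set.mem_singleton_iff]
    constructor
    · rintro ⟨hz, hpole⟩
      by_cases hzρ : z ∈ ball zhat ρ
      · exact hzero z (ball_subset_closedBall hzρ)
          ((isPole_iff_recip_eq_zero hy (han z hzρ)).1 hpole)
      · exact absurd hpole.2 (not_lt.2 (houter z hz hzρ).1.meromorphicOrderAt_nonneg)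
    · rintro (rfl | rfl)
      · exact ⟨hball hzp, (isPole_iff_recip_eq_zero hy (han _ hzp)).2 hup⟩
      · exact ⟨hball hzm, (isPole_iff_recip_eq_zero hy (han _ hzm)).2 hum⟩
  · exact isSimplePoleWithResidue_of_deriv_recip hy (han zp hzp) hup hpp hε3
  · rw [← inv_neg]
    exact isSimplePoleWithResidue_of_deriv_recip hy (han zm hzm) hum hmp (neg_ne_zero.2 hε3)
  · ext z
    simp only [Set.mem_ofPred_eq, Set.mem_singleton_iff]
    constructor
    · rintro ⟨hz, hst⟩
      by_cases hzρ : z ∈ ball zhat ρ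
      · exact hstat z (ball_subset_closedBall hzρ)
          ((isStationaryPoint_iff_of_analyticAt_recip hy (han z hzρ)).1 hst).2
      · exact absurd hst.2 (houter z hz hzρ).2
    · rintro rfl
      exact ⟨hball hz₁, (isStationaryPoint_iff_of_analyticAt_recip hy (han _ hz₁)).2
        ⟨hu1ne, h1p⟩⟩
  · rw [hyu]
    exact hA.trans hκη
  · rw [hyu]
    exact hd
  · nlinarith [norm_nonneg (zp - zm)]
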